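/- Let $(W,S)$ be a Coxeter system with $W$ finite and $|S|=m$. For $J\subseteq S$ let $\langle J\rangle$ be the subgroup generated by $J$, and for $-1\le r\le m$ let $$C_W(r)=\operatorname{span}_{\mathbb F_2}\{\mathbb 1_{\sigma\langle J\rangle} : \sigma\in W,\ J\subseteq S,\ |J|=m-r\}\subseteq \mathbb F_2^{W}$$ be the order-$r$ Coxeter code. For $w\in W$ let $d(w)=|\{s\in S:\ell(ws)<\ell(w)\}|$ be its descent number, and let $\varepsilon(W,i)=|\{w\in W: d(w)=i\}|$ be the $W$-Eulerian numbers. For binary linear codes $C_1,C_2$ of length $n$ with $C_1^\perp\subseteq C_2$, let $\mathrm{CSS}(C_1,C_2)$ be the $n$-qubit stabilizer code whose stabilizer group is generated by the Pauli operators $X^x$ ($x\in C_1^\perp$) and $Z^z$ ($z\in C_2^\perp$). It has parameters $[[n,k]]$ if its code space, the joint $+1$ eigenspace of the stabilizers in $(\mathbb C^2)^{\otimes n}$, has dimension $2^k$; its distance is the minimum weight of a Pauli operator that commutes with all stabilizers but is not a scalar multiple of a stabilizer. Let $-1\le q\le r\le m$. Then $C_W(m-q-1)^\perp\subseteq C_W(r)$,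 and the quantum Coxeter code $Q_W(q,r)=\mathrm{CSS}(C_W(m-q-1),C_W(r))$ is a stabilizer code with parameters $$\Big[\Big[\,n=|W|,\ k=\sum_{i=q+1}^{r}\varepsilon(W,i)\,\Big]\Big].$$ If moreover $q<r$ (so that the distance is defined), its distance is $d=2^{\min(q+1,\,m-r)}$. -/

import Mathlib

open scoped Pointwise

namespace QCoxeter

/-! ### Coxeter codes -/

section Coxeter

variable {B W : Type*} [Group W] {M : CoxeterMatrix B}

/-- The standard subgroup `⟨J⟩` generated by the simple reflections indexed by `J`. -/
def standardSubgroup (cs : CoxeterSystem M W) (J : Finset B) : Subgroup W :=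
  Subgroup.closure (cs.simple '' (J : Set B))

/-- The order-`r` Coxeter code: the span over `𝔽₂` of the indicator functions of the left cosets
`σ⟨J⟩` with `|J| = m - r`, where `m = |B|` is the rank of the system. -/
noncomputable def coxeterCode [Fintype B] (cs : CoxeterSystem M W) (r : ℤ) :
    Submodule (ZMod 2) (W → ZMod 2) :=
  Submodule.span (ZMod 2)
    {f | ∃ (σ : W) (J : Finset B), (J.card : ℤ) = (Fintype.card B : ℤ) - r ∧
      f = Set.indicator (σ • (standardSubgroup cs J : Set W)) 1}

/-- The (right) descent number of `w`. -/
noncomputable def descentNumber (cs : CoxeterSystem M W) (w : W) : ℕ :=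
  {i : B | cs.IsRightDescent w i}.ncard

/-- The `W`-Eulerian number: how many elements of `W` have descent number `i`. -/
noncomputable def eulerian (cs : CoxeterSystem M W) (i : ℕ) : ℕ :=
  {w : W | descentNumber cs w = i}.ncard

end Coxeter

/-! ### Stabilizer codes and CSS codes on qubits indexed by a finite type `ι` -/

section Quantum

variable {ι : Type*} [Fintype ι]

/-- The dual of a binary linear code with respect to the standard dot product. -/
def dualCode (C : Submodule (ZMod 2) (ι → ZMod 2)) : Submodule (ZMod 2) (ι → ZMod 2) where
  carrier := {y | ∀ x ∈ C, x ⬝ᵥ y = 0}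
  zero_mem' := fun x _ => dotProduct_zero x
  add_mem' := by
    intro a b ha hb x hx
    rw [dotProduct_add, ha x hx, hb x hx, add_zero]
  smul_mem' := by
    intro c a ha x hx
    rw [dotProduct_smul, ha x hx, smul_zero]

/-- Operators on `(ℂ²)^{⊗ι}`, as matrices in the computational basis `ι → Fin 2`. -/
abbrev Op (ι : Type*) : Type _ := Matrix (ι → Fin 2) (ι → Fin 2) ℂ

/-- The tensor (Kronecker) product `⨂ i, A i` of single-qubit operators. -/
def tensorOp (A : ι → Matrix (Fin 2) (Fin 2) ℂ) : Op ι :=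
  Matrix.of fun a b => ∏ i, A i (a i) (b i)

/-- The Pauli matrix `X`. -/
def pauliX : Matrix (Fin 2) (Fin 2) ℂ := !![0, 1; 1, 0]

/-- The Pauli matrix `Z`. -/
def pauliZ : Matrix (Fin 2) (Fin 2) ℂ := !![1, 0; 0, -1]

/-- `X^x = ⨂ i, X^{x_i}`. -/
def xOp (x : ι → ZMod 2) : Op ι := tensorOp fun i => pauliX ^ (x i).val

/-- `Z^z = ⨂ i, Z^{z_i}`. -/
def zOp (z : ι → ZMod 2) : Op ι := tensorOp fun i => pauliZ ^ (z i).val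

/-- The number of qubits on which `X^x Z^z` does not act as a multiple of the identity. -/
def pauliWeight (x z : ι → ZMod 2) : ℕ :=
  (Finset.univ.filter fun i => x i ≠ 0 ∨ z i ≠ 0).card

variable [DecidableEq ι]

/-- The Pauli operator `X^x Z^z`; up to a phase, every `n`-qubit Pauli operator is of this form. -/
def pauli (x z : ι → ZMod 2) : Op ι := xOp x * zOp z

/-- `S` is a stabilizer group: a commutative set of Pauli operators, closed under products, that
does not contain `-1`. (Such a submonoid is a group, as Pauli operators have finite order.) -/
structure IsStabilizerGroup (S : Submonoid (Op ι)) : Prop where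
  isPauli : ∀ s ∈ S, ∃ (c : ℂ) (x z : ι → ZMod 2), c ^ 4 = 1 ∧ s = c • pauli x z
  commute : ∀ s ∈ S, ∀ t ∈ S, Commute s t
  neg_one_notMem : (-1 : Op ι) ∉ S

/-- The code space stabilized by `S`: the joint `+1` eigenspace of the elements of `S`. -/
def codeSpace (S : Submonoid (Op ι)) : Submodule ℂ ((ι → Fin 2) → ℂ) where
  carrier := {ψ | ∀ s ∈ S, Matrix.mulVec s ψ = ψ}
  zero_mem' := fun s _ => Matrix.mulVec_zero s
  add_mem' := by
    intro a b ha hb s hs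
    rw [Matrix.mulVec_add, ha s hs, hb s hs]
  smul_mem' := by
    intro c a ha s hs
    rw [Matrix.mulVec_smul, ha s hs]

/-- The weights of the nontrivial logical Pauli operators of `S`: the Pauli operators that commute
with every stabilizer and are not, up to a scalar, stabilizers themselves. -/
def logicalWeights (S : Submonoid (Op ι)) : Set ℕ :=
  {w | ∃ x z : ι → ZMod 2, (∀ s ∈ S, Commute s (pauli x z)) ∧
    (∀ c : ℂ, c • pauli x z ∉ S) ∧ w = pauliWeight x z}

/-- `S` defines an `[[n, k]]` stabilizer code: `n` physical qubits, `k` logical qubits. -/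
structure IsCode (S : Submonoid (Op ι)) (n k : ℕ) : Prop where
  isStabilizerGroup : IsStabilizerGroup S
  length_eq : Fintype.card ι = n
  finrank_eq : Module.finrank ℂ (codeSpace S) = 2 ^ k

/-- The stabilizer code of `S` has distance `d`: the least weight of a nontrivial logical Pauli
operator exists and equals `d`. -/
def HasDistance (S : Submonoid (Op ι)) (d : ℕ) : Prop :=
  IsLeast (logicalWeights S) d

/-- The stabilizer group of `CSS(C₁, C₂)`, generated by `X^x` for `x ∈ C₁^⊥` and `Z^z` for
`z ∈ C₂^⊥`. -/
def css (C₁ C₂ : Submodule (ZMod 2) (ι → ZMod 2)) : Submonoid (Op ι) :=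
  Submonoid.closure
    ({A | ∃ x ∈ dualCode C₁, A = xOp x} ∪ {A | ∃ z ∈ dualCode C₂, A = zOp z})

end Quantum

/-- The order-`(q, r)` quantum Coxeter code `CSS(C_W(m - q - 1), C_W(r))`, with qubits indexed by
the elements of `W`. -/
noncomputable def quantumCoxeter {B W : Type*} [Fintype B] [Group W] [Fintype W] [DecidableEq W]
    {M : CoxeterMatrix B} (cs : CoxeterSystem M W) (q r : ℤ) : Submonoid (Op W) :=
  css (coxeterCode cs ((Fintype.card B : ℤ) - q - 1)) (coxeterCode cs r)

end QCoxeter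

/-!
Write `m` for the rank. For each `w`, take the indicator word of `w⟨J⟩`, where `J` is the set of
non-descents of `w`. Since `w` is the shortest element of `w⟨J⟩`, these words are triangular with
respect to length, hence independent; those with `d(w) ≤ r` lie in `C_W(r)`. Two standard cosets of
types `J` and `K` with `J ∩ K ≠ ∅` meet in an even set, so `C_W(m - r - 1) ≤ C_W(r)^⊥`, and as
multiplication by the longest element exchanges descents and non-descents the two dimension bounds
add up to `|W|`. Hence the words with `d(w) ≤ r` form a basis of `C_W(r)`, and
`C_W(r)^⊥ = C_W(m - r - 1)`.

A word orthogonal to all `σ⟨K⟩` with `|K| = k` and nonzero somewhere on a coset `σ⟨J⟩` is nonzero at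
two points of it which are separated by a maximal standard subgroup of `⟨J⟩`; halving repeatedly,
nonzero words of `C_W(r)` have weight at least `2 ^ (m - r)`. The bound is attained once
`m ≤ 2 * r`: averaging an inner product over `W` shows that the Coxeter graph is a forest, hence
bipartite, so at least half of the generators commute pairwise, and any `m - r` of these generate a
subgroup of order `2 ^ (m - r)`. Its indicator word is too light to lie in `C_W(r - 1)`.

The code space of `CSS(C₁, C₂)` consists of the states supported on `C₂` and constant on the cosets
of `C₁^⊥`, and the nontrivial logical operators of least weight are pure products of `X`s or of
`Z`s, given by words of `C₂ \ C₁^⊥` and `C₁ \ C₂^⊥`.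
-/

namespace QCoxeter

/-! ### The geometric representation -/

section Geometric

open Module Polynomial.Chebyshev

variable {B : Type*}

/-- The matrix `-cos (π / m_{ij})` of the canonical form; an infinite label, encoded as `0`, gives
`-1`. -/
noncomputable def gram (M : CoxeterMatrix B) (i j : B) : ℝ := -Real.cos (Real.pi / M i j)

theorem gram_self (M : CoxeterMatrix B) (i : B) : gram M i i = 1 := by
  simp [gram]

theorem gram_symm (M : CoxeterMatrix B) (i j : B) : gram M i j = gram M j i := by
  simp [gram, M.symmetric i j]

theorem gram_eq_zero {M : CoxeterMatrix B} {i j : B} (h : M i j = 2) : gram M i j = 0 := by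
  simp [gram, h]

theorem gram_le_neg_half {M : CoxeterMatrix B} {i j : B} (hij : i ≠ j) (h : M i j ≠ 2) :
    gram M i j ≤ -(1 / 2) := by
  rw [gram, neg_le_neg_iff]
  rcases Nat.eq_zero_or_pos (M i j) with h0 | hpos
  · norm_num [h0]
  rw [← Real.cos_pi_div_three]
  have h1 : M i j ≠ 1 := M.off_diagonal i j hij
  have h3 : (3 : ℝ) ≤ M i j := by exact_mod_cast (by omega : 3 ≤ M i j)
  apply Real.cos_le_cos_of_nonneg_of_le_pi (by positivity) (by linarith [Real.pi_pos])
  gcongr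

theorem gram_nonpos {M : CoxeterMatrix B} {i j : B} (hij : i ≠ j) : gram M i j ≤ 0 := by
  by_cases h : M i j = 2
  · exact (gram_eq_zero h).le
  · linarith [gram_le_neg_half hij h]

/-- The coroot of the `i`-th simple reflection, as a functional on the root space `B →₀ ℝ`, in which
the `i`-th simple root is `Finsupp.single i 1`. -/
noncomputable def coroot (M : CoxeterMatrix B) (i : B) : Dual ℝ (B →₀ ℝ) :=
  Finsupp.linearCombination ℝ fun j => 2 * gram M i j

theorem coroot_single (M : CoxeterMatrix B) (i j : B) :
    coroot M i (Finsupp.single j 1) = 2 * gram M i j := by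
  simp [coroot]

theorem coroot_self (M : CoxeterMatrix B) (i : B) : coroot M i (Finsupp.single i 1) = 2 := by
  rw [coroot_single, gram_self, mul_one]

/-- The reflection in the `i`-th simple root. -/
noncomputable def geomReflection (M : CoxeterMatrix B) (i : B) : (B →₀ ℝ) ≃ₗ[ℝ] (B →₀ ℝ) :=
  reflection (coroot_self M i)

theorem geomReflection_apply (M : CoxeterMatrix B) (i : B) (v : B →₀ ℝ) :
    geomReflection M i v = v - coroot M i v • Finsupp.single i 1 :=
  reflection_apply _ _

theorem eval_chebyshevS_sub_one_eq_zero {θ : ℝ} (hθ : Real.sin θ ≠ 0) {k : ℤ}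
    (hk : k * θ = Real.pi) : (S ℝ (k - 1)).eval (2 * Real.cos θ) = 0 := by
  have h := S_two_mul_real_cos θ (k - 1)
  rw [Int.cast_sub, Int.cast_one, sub_add_cancel, hk, Real.sin_pi] at h
  exact (mul_eq_zero.mp h).resolve_right hθ

theorem eval_chebyshevS_add_eq_zero {θ : ℝ} (hθ : Real.sin θ ≠ 0) {k : ℤ}
    (hk : (2 * k + 1) * θ = 2 * Real.pi) :
    (S ℝ k).eval (2 * Real.cos θ) + (S ℝ (k - 1)).eval (2 * Real.cos θ) = 0 := by
  have h₁ := S_two_mul_real_cos θ k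
  have h₂ := S_two_mul_real_cos θ (k - 1)
  rw [Int.cast_sub, Int.cast_one, sub_add_cancel] at h₂
  rw [show (k + 1 : ℝ) * θ = 2 * Real.pi - k * θ by linarith, Real.sin_two_pi_sub] at h₁
  refine (mul_eq_zero.mp ?_).resolve_right hθ
  rw [add_mul, h₁, h₂, neg_add_cancel]

theorem geomReflection_mul_pow_eq_one {M : CoxeterMatrix B} {i j : B} (h : 3 ≤ M i j) :
    (geomReflection M i * geomReflection M j) ^ M i j = 1 := by
  set m := M i j with hm
  set θ := 2 * Real.pi / m with hθ
  have hm3 : (3 : ℝ) ≤ m := by exact_mod_cast h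
  have hmθ : m * θ = 2 * Real.pi := by rw [hθ]; field_simp
  have hsin : Real.sin θ ≠ 0 := by
    refine (Real.sin_pos_of_pos_of_lt_pi (by positivity) ?_).ne'
    rw [hθ, div_lt_iff₀ (by positivity)]
    nlinarith [Real.pi_pos]
  have htrace : 2 * Real.cos θ =
      coroot M i (Finsupp.single j 1) * coroot M j (Finsupp.single i 1) - 2 := by
    rw [coroot_single, coroot_single, gram_symm M j i, gram, ← hm, hθ, mul_div_assoc,
      Real.cos_two_mul]
    ring
  refine LinearEquiv.ext fun v => ?_
  have hpow := reflection_mul_reflection_pow_apply (coroot_self M i) (coroot_self M j) m v _ htrace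
  rcases Nat.even_or_odd' m with ⟨k, hk | hk⟩
  · have hzero : (S ℝ ((k : ℤ) - 1)).eval (2 * Real.cos θ) = 0 := by
      refine eval_chebyshevS_sub_one_eq_zero hsin ?_
      rw [hk] at hmθ
      push_cast at hmθ ⊢
      linarith
    rw [show ((m : ℤ) - 2) / 2 = k - 1 by omega, show ((m : ℤ) - 1) / 2 = k - 1 by omega,
      hzero] at hpow
    simpa [geomReflection] using hpow
  · have hzero : (S ℝ (k : ℤ)).eval (2 * Real.cos θ) +
        (S ℝ ((k : ℤ) - 1)).eval (2 * Real.cos θ) = 0 := by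
      refine eval_chebyshevS_add_eq_zero hsin ?_
      rw [hk] at hmθ
      exact_mod_cast hmθ
    rw [show ((m : ℤ) - 2) / 2 = k - 1 by omega, show ((m : ℤ) - 1) / 2 = k by omega,
      show ((m : ℤ) - 3) / 2 = k - 1 by omega, show (m : ℤ) / 2 = k by omega, hzero] at hpow
    simpa [geomReflection] using hpow

theorem geomReflection_isLiftable (M : CoxeterMatrix B) : M.IsLiftable (geomReflection M) := by
  intro i j
  rcases eq_or_ne i j with rfl | hij
  · rw [M.diagonal, pow_one]
    exact LinearEquiv.ext (involutive_reflection (coroot_self M i))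
  have h1 : M i j ≠ 1 := M.off_diagonal i j hij
  obtain h0 | h2 | h3 : M i j = 0 ∨ M i j = 2 ∨ 3 ≤ M i j := by omega
  · rw [h0, pow_zero]
  · have h2' : M j i = 2 := by rw [M.symmetric j i, h2]
    rw [h2, pow_two]
    refine LinearEquiv.ext fun v => ?_
    simp only [LinearEquiv.mul_apply, geomReflection_apply, map_sub, map_smul, coroot_self,
      coroot_single, gram_eq_zero h2, gram_eq_zero h2', LinearEquiv.coe_one, id]
    module
  · exact geomReflection_mul_pow_eq_one h3

variable {W : Type*} [Group W] {M : CoxeterMatrix B}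

/-- The geometric representation of a Coxeter group. -/
noncomputable def geomRep (cs : CoxeterSystem M W) : W →* ((B →₀ ℝ) ≃ₗ[ℝ] (B →₀ ℝ)) :=
  cs.lift ⟨geomReflection M, geomReflection_isLiftable M⟩

theorem geomRep_simple (cs : CoxeterSystem M W) (i : B) (v : B →₀ ℝ) :
    geomRep cs (cs.simple i) v = v - coroot M i v • Finsupp.single i 1 := by
  rw [geomRep, cs.lift_apply_simple, geomReflection_apply]

theorem geomRep_apply_of_notMem (cs : CoxeterSystem M W) {J : Finset B} {i : B} (hi : i ∉ J)
    {u : W} (hu : u ∈ standardSubgroup cs J) (v : B →₀ ℝ) : geomRep cs u v i = v i := by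
  induction hu using Subgroup.closure_induction generalizing v with
  | mem x hx =>
    obtain ⟨j, hj, rfl⟩ := hx
    have hji : j ≠ i := fun h => hi (h ▸ hj)
    simp [geomRep_simple, hji]
  | one => simp
  | mul x y _ _ hx hy => rw [map_mul, LinearEquiv.mul_apply, hx, hy]
  | inv x _ hx => rw [← hx, ← LinearEquiv.mul_apply, ← map_mul, mul_inv_cancel, map_one,
      LinearEquiv.coe_one, id]

theorem simple_mem_standardSubgroup_iff (cs : CoxeterSystem M W) {J : Finset B} {i : B} :
    cs.simple i ∈ standardSubgroup cs J ↔ i ∈ J := by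
  refine ⟨fun h => ?_, fun h => Subgroup.subset_closure ⟨i, h, rfl⟩⟩
  by_contra hi
  have hfix := geomRep_apply_of_notMem cs hi h (Finsupp.single i 1)
  rw [geomRep_simple, coroot_self] at hfix
  norm_num at hfix

end Geometric

/-! ### The Coxeter graph of a finite Coxeter group -/

section CoxeterGraph

variable {B : Type*}

theorem exists_invariant_posDef {G V : Type*} [Group G] [Finite G] [AddCommGroup V] [Module ℝ V]
    (ρ : G →* V ≃ₗ[ℝ] V) (b₀ : LinearMap.BilinForm ℝ V) (hb₀ : ∀ v ≠ 0, 0 < b₀ v v) :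
    ∃ b : LinearMap.BilinForm ℝ V,
      (∀ g v w, b (ρ g v) (ρ g w) = b v w) ∧ ∀ v ≠ 0, 0 < b v v := by
  have := Fintype.ofFinite G
  refine ⟨∑ g, b₀.compl₁₂ (ρ g) (ρ g), fun h v w => ?_, fun v hv => ?_⟩
  · simp only [LinearMap.sum_apply, LinearMap.compl₁₂_apply, LinearEquiv.coe_coe]
    refine Fintype.sum_equiv (Equiv.mulRight h) _ _ fun g => ?_
    simp only [Equiv.coe_mulRight, map_mul, LinearEquiv.mul_apply]
  · simp only [LinearMap.sum_apply, LinearMap.compl₁₂_apply, LinearEquiv.coe_coe]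
    exact Finset.sum_pos (fun g _ => hb₀ _ (by simpa using hv)) Finset.univ_nonempty

theorem exists_posDef_finsupp (B : Type*) :
    ∃ b : LinearMap.BilinForm ℝ (B →₀ ℝ), ∀ v ≠ 0, 0 < b v v := by
  refine ⟨Finsupp.linearCombination ℝ fun i => Finsupp.lapply i, fun v hv => ?_⟩
  rw [Finsupp.linearCombination_apply, Finsupp.sum, LinearMap.sum_apply]
  refine Finset.sum_pos (fun i hi => ?_) (Finsupp.support_nonempty_iff.mpr hv)
  exact mul_self_pos.mpr (Finsupp.mem_support_iff.mp hi)

/-- The Coxeter graph: two generators are joined when they do not commute. -/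
def coxeterGraph (M : CoxeterMatrix B) : SimpleGraph B where
  Adj i j := i ≠ j ∧ M i j ≠ 2
  symm := ⟨fun i j h => ⟨h.1.symm, by rw [M.symmetric]; exact h.2⟩⟩
  loopless := ⟨fun _ h => h.1 rfl⟩

theorem sum_gram_nonpos {M : CoxeterMatrix B} {i : B} {T N : Finset B} (hi : i ∈ T) (hNT : N ⊆ T)
    (hN : ∀ j ∈ N, (coxeterGraph M).Adj i j) (hcard : 2 ≤ N.card) : ∑ j ∈ T, gram M i j ≤ 0 := by
  classical
  have hiN : i ∉ N := fun h => (hN i h).1 rfl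
  have hsub : insert i N ⊆ T := Finset.insert_subset hi hNT
  calc ∑ j ∈ T, gram M i j
      ≤ ∑ j ∈ insert i N, gram M i j := by
        rw [← Finset.sum_sdiff hsub]
        refine add_le_of_nonpos_left (Finset.sum_nonpos fun j hj => gram_nonpos ?_)
        rintro rfl
        exact (Finset.mem_sdiff.mp hj).2 (Finset.mem_insert_self _ _)
    _ = 1 + ∑ j ∈ N, gram M i j := by rw [Finset.sum_insert hiN, gram_self]
    _ ≤ 1 + N.card • (-(1 / 2) : ℝ) := by
        gcongr
        exact Finset.sum_le_card_nsmul _ _ _ fun j hj => gram_le_neg_half (hN j hj).1 (hN j hj).2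
    _ ≤ 0 := by
        have : (2 : ℝ) ≤ N.card := by exact_mod_cast hcard
        rw [nsmul_eq_mul]
        linarith

variable {W : Type*} [Group W] {M : CoxeterMatrix B}

theorem exists_sum_gram_pos [Finite W] (cs : CoxeterSystem M W) {T : Finset B} (hT : T.Nonempty) :
    ∃ i ∈ T, 0 < ∑ j ∈ T, gram M i j := by
  classical
  obtain ⟨b₀, hb₀⟩ := exists_posDef_finsupp B
  obtain ⟨b, hinv, hpos⟩ := exists_invariant_posDef (geomRep cs) b₀ hb₀
  have hroot (i : B) (v : B →₀ ℝ) : 2 * b (Finsupp.single i 1) v =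
      coroot M i v * b (Finsupp.single i 1) (Finsupp.single i 1) := by
    have h := hinv (cs.simple i) (Finsupp.single i 1) v
    simp only [geomRep_simple, coroot_self, map_sub, map_smul, LinearMap.sub_apply,
      LinearMap.smul_apply, smul_eq_mul] at h
    linarith
  set v : B →₀ ℝ := ∑ i ∈ T, Finsupp.single i 1 with hv
  have hv0 : v ≠ 0 := by
    obtain ⟨i, hi⟩ := hT
    refine fun h => one_ne_zero (α := ℝ) ?_
    simpa [hv, Finsupp.finsetSum_apply, Finsupp.single_apply, hi] using DFunLike.congr_fun h i
  by_contra! hle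
  refine (hpos v hv0).not_ge ?_
  calc b v v = ∑ i ∈ T, b (Finsupp.single i 1) v := by
        conv_lhs => enter [1]; rw [hv, map_sum]
        rw [LinearMap.sum_apply]
    _ ≤ 0 := Finset.sum_nonpos fun i hi => by
        have hcoroot : coroot M i v = 2 * ∑ j ∈ T, gram M i j := by
          simp only [hv, map_sum, coroot_single, Finset.mul_sum]
        have hself : 0 < b (Finsupp.single i 1) (Finsupp.single i 1) := hpos _ (by simp)
        have := hroot i v
        nlinarith [hle i hi]

theorem coxeterGraph_isAcyclic [Finite W] (cs : CoxeterSystem M W) :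
    (coxeterGraph M).IsAcyclic := by
  classical
  intro i₀ p hp
  obtain ⟨i, hi, hsum⟩ := exists_sum_gram_pos cs (T := p.support.toFinset) ⟨i₀, by simp⟩
  rw [List.mem_toFinset] at hi
  have hfin : (p.toSubgraph.neighborSet i).Finite :=
    Set.finite_of_ncard_pos (by rw [hp.ncard_neighborSet_toSubgraph_eq_two hi]; exact two_pos)
  refine hsum.not_ge (sum_gram_nonpos (N := hfin.toFinset) (List.mem_toFinset.mpr hi)
    (fun j hj => ?_) (fun j hj => ?_) ?_)
  · have hadj : p.toSubgraph.Adj i j := hfin.mem_toFinset.mp hj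
    simpa using hadj.snd_mem
  · exact SimpleGraph.Subgraph.adj_sub _ (hfin.mem_toFinset.mp hj)
  · rw [← Set.ncard_eq_toFinset_card _ hfin, hp.ncard_neighborSet_toSubgraph_eq_two hi]

theorem exists_pairwise_eq_two [Fintype B] [Finite W] (cs : CoxeterSystem M W) :
    ∃ I : Finset B, Fintype.card B ≤ 2 * I.card ∧ (I : Set B).Pairwise fun i j => M i j = 2 := by
  obtain ⟨color⟩ := (coxeterGraph_isAcyclic cs).isBipartite
  obtain ⟨c, hc⟩ := Fintype.exists_le_card_fiber_of_nsmul_le_card color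
    (b := (Fintype.card B / 2 : ℚ)) (by simp [mul_div_cancel₀])
  refine ⟨Finset.univ.filter fun i => color i = c, ?_, fun i hi j hj hij => ?_⟩
  · rw [div_le_iff₀' two_pos] at hc
    exact_mod_cast hc
  · by_contra h
    rw [Finset.mem_coe, Finset.mem_filter_univ] at hi hj
    exact color.valid ⟨hij, h⟩ (hi.trans hj.symm)

end CoxeterGraph

/-! ### The inversion cocycle -/

section Cocycle

variable {B W : Type*} [Group W] {M : CoxeterMatrix B}

theorem prod_map_reverse_alternatingWord {G : Type*} [Monoid G] (f : B → G) (i j : B) (p : ℕ) :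
    ((CoxeterSystem.alternatingWord i j (2 * p)).reverse.map f).prod = (f j * f i) ^ p := by
  induction p with
  | zero => simp [CoxeterSystem.alternatingWord]
  | succ p ih =>
    rw [mul_add_one, CoxeterSystem.alternatingWord_succ', CoxeterSystem.alternatingWord_succ',
      if_neg (by simp [parity_simps]), if_pos (by simp), List.reverse_cons, List.reverse_cons,
      List.map_append, List.map_append, List.prod_append, List.prod_append, ih, pow_succ]
    simp [mul_assoc]

open scoped Classical in
theorem even_count_leftInvSeq_alternatingWord (cs : CoxeterSystem M W) (i j : B) (t : W) :
    Even ((cs.leftInvSeq (CoxeterSystem.alternatingWord i j (2 * M i j))).count t) := by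
  set l := cs.leftInvSeq (CoxeterSystem.alternatingWord i j (2 * M i j)) with hl
  have hlen : l.length = 2 * M i j := by simp [hl]
  have hperiodic : l.drop (M i j) = l.take (M i j) := by
    refine List.ext_getElem (by simp [hlen, two_mul]) fun k h₁ h₂ => ?_
    have hk : k < M i j := by simp_all
    simp only [List.getElem_drop, List.getElem_take, hl]
    rw [cs.getElem_leftInvSeq_alternatingWord _ _ _ _ (by omega),
      cs.getElem_leftInvSeq_alternatingWord _ _ _ _ (by omega),
      cs.prod_alternatingWord_eq_mul_pow, cs.prod_alternatingWord_eq_mul_pow,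
      show (2 * (M i j + k) + 1) / 2 = M i j + k by omega, show (2 * k + 1) / 2 = k by omega,
      pow_add, cs.simple_mul_simple_pow', one_mul]
    simp
  rw [← List.take_append_drop (M i j) l, hperiodic, List.count_append]
  exact ⟨_, rfl⟩

open scoped Classical in
/-- The action of a simple reflection on signed group elements `(t, ε)`: it conjugates `t`, and
flips the sign exactly when `t` is that simple reflection. -/
noncomputable def signedPerm (cs : CoxeterSystem M W) (i : B) : Equiv.Perm (W × ZMod 2) :=
  Function.Involutive.toPerm
    (fun p => (cs.simple i * p.1 * cs.simple i, p.2 + if p.1 = cs.simple i then 1 else 0)) <| by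
    rintro ⟨t, ε⟩
    have hconj : cs.simple i * t * cs.simple i = cs.simple i ↔ t = cs.simple i := by
      rw [mul_eq_right, mul_eq_one_iff_eq_inv', cs.inv_simple]
    refine Prod.ext (by simp [mul_assoc]) ?_
    simp only [hconj, add_assoc, CharTwo.add_self_eq_zero, add_zero]

open scoped Classical in
theorem signedPerm_apply (cs : CoxeterSystem M W) (i : B) (t : W) (ε : ZMod 2) :
    signedPerm cs i (t, ε) =
      (cs.simple i * t * cs.simple i, ε + if t = cs.simple i then 1 else 0) :=
  rfl

open scoped Classical in
theorem prod_map_signedPerm_apply (cs : CoxeterSystem M W) (ω : List B) (t : W) (ε : ZMod 2) :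
    (ω.map (signedPerm cs)).prod (t, ε) =
      (cs.wordProd ω * t * (cs.wordProd ω)⁻¹, ε + ((cs.rightInvSeq ω).count t : ZMod 2)) := by
  induction ω with
  | nil => simp
  | cons i ω ih =>
    have hconj : cs.wordProd ω * t * (cs.wordProd ω)⁻¹ = cs.simple i ↔
        (cs.wordProd ω)⁻¹ * cs.simple i * cs.wordProd ω = t := by
      rw [mul_inv_eq_iff_eq_mul, mul_assoc, inv_mul_eq_iff_eq_mul, eq_comm]
    rw [List.map_cons, List.prod_cons, Equiv.Perm.mul_apply, ih, signedPerm_apply,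
      cs.wordProd_cons, CoxeterSystem.rightInvSeq, List.count_cons]
    refine Prod.ext (by simp [mul_assoc]) ?_
    simp [hconj, add_assoc]

theorem signedPerm_isLiftable (cs : CoxeterSystem M W) : M.IsLiftable (signedPerm cs) := by
  classical
  intro i j
  refine Equiv.ext fun ⟨t, ε⟩ => ?_
  obtain ⟨c, hc⟩ := even_count_leftInvSeq_alternatingWord cs j i t
  have hword := prod_map_signedPerm_apply cs
    (CoxeterSystem.alternatingWord j i (2 * M j i)).reverse t ε
  rw [prod_map_reverse_alternatingWord, cs.rightInvSeq_reverse, List.count_reverse, hc,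
    CoxeterSystem.wordProd, prod_map_reverse_alternatingWord, M.symmetric j i,
    cs.simple_mul_simple_pow, Nat.cast_add, CharTwo.add_self_eq_zero] at hword
  simpa using hword

/-- The action of a Coxeter group on its signed elements. -/
noncomputable def signedAction (cs : CoxeterSystem M W) : W →* Equiv.Perm (W × ZMod 2) :=
  cs.lift ⟨signedPerm cs, signedPerm_isLiftable cs⟩

/-- The inversion cocycle: on reflections `t`, it indicates whether `t` is a right inversion
of `w`. -/
noncomputable def invCocycle (cs : CoxeterSystem M W) (w t : W) : ZMod 2 :=
  (signedAction cs w (t, 0)).2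

variable (cs : CoxeterSystem M W)

open scoped Classical in
theorem signedAction_wordProd (ω : List B) (t : W) (ε : ZMod 2) :
    signedAction cs (cs.wordProd ω) (t, ε) =
      (cs.wordProd ω * t * (cs.wordProd ω)⁻¹, ε + ((cs.rightInvSeq ω).count t : ZMod 2)) := by
  rw [← prod_map_signedPerm_apply, CoxeterSystem.wordProd, map_list_prod, List.map_map]
  congr! 3
  exact funext (cs.lift_apply_simple _)

open scoped Classical in
theorem invCocycle_wordProd (ω : List B) (t : W) :
    invCocycle cs (cs.wordProd ω) t = ((cs.rightInvSeq ω).count t : ZMod 2) := by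
  rw [invCocycle, signedAction_wordProd, zero_add]

theorem signedAction_apply (w t : W) (ε : ZMod 2) :
    signedAction cs w (t, ε) = (w * t * w⁻¹, ε + invCocycle cs w t) := by
  classical
  obtain ⟨ω, rfl⟩ := cs.wordProd_surjective w
  rw [signedAction_wordProd, invCocycle_wordProd]

theorem invCocycle_mul (u v t : W) :
    invCocycle cs (u * v) t = invCocycle cs v t + invCocycle cs u (v * t * v⁻¹) := by
  rw [invCocycle, map_mul, Equiv.Perm.mul_apply, signedAction_apply, signedAction_apply, zero_add]

theorem invCocycle_one (t : W) : invCocycle cs 1 t = 0 := by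
  simp [invCocycle]

open scoped Classical in
theorem invCocycle_simple (i : B) (t : W) :
    invCocycle cs (cs.simple i) t = if t = cs.simple i then 1 else 0 := by
  rw [invCocycle, signedAction, cs.lift_apply_simple, signedPerm_apply, zero_add]

theorem invCocycle_reflection_self {t : W} (ht : cs.IsReflection t) : invCocycle cs t t = 1 := by
  obtain ⟨w, i, rfl⟩ := ht
  have hinv := invCocycle_mul cs w⁻¹ w (cs.simple i)
  rw [inv_mul_cancel, invCocycle_one] at hinv
  rw [invCocycle_mul, invCocycle_mul,
    show w⁻¹ * (w * cs.simple i * w⁻¹) * w⁻¹⁻¹ = cs.simple i by group, mul_inv_cancel_right,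
    invCocycle_simple, if_pos rfl]
  linear_combination -hinv

theorem isRightInversion_of_invCocycle_ne_zero {w t : W} (h : invCocycle cs w t ≠ 0) :
    cs.IsRightInversion w t := by
  classical
  obtain ⟨ω, hω, rfl⟩ := cs.exists_isReduced w
  refine cs.isRightInversion_of_mem_rightInvSeq hω ?_
  contrapose! h
  rw [invCocycle_wordProd, List.count_eq_zero_of_not_mem h, Nat.cast_zero]

theorem isRightInversion_iff_invCocycle {w t : W} (ht : cs.IsReflection t) :
    cs.IsRightInversion w t ↔ invCocycle cs w t = 1 := by
  refine ⟨fun h => Fin.eq_one_of_ne_zero _ fun h0 => ?_, fun h =>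
    isRightInversion_of_invCocycle_ne_zero cs (h ▸ one_ne_zero)⟩
  refine ht.isRightInversion_mul_left_iff.mp (isRightInversion_of_invCocycle_ne_zero cs ?_) h
  rw [invCocycle_mul, invCocycle_reflection_self cs ht, mul_inv_cancel_right, h0]
  decide

theorem isRightDescent_iff_invCocycle {w : W} {i : B} :
    cs.IsRightDescent w i ↔ invCocycle cs w (cs.simple i) = 1 := by
  rw [← cs.isRightInversion_simple_iff_isRightDescent,
    isRightInversion_iff_invCocycle cs (cs.isReflection_simple i)]

end Cocycle

/-! ### Standard subgroups and descents -/

section Standard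

variable {B W : Type*} [Group W] {M : CoxeterMatrix B} (cs : CoxeterSystem M W)

theorem simple_mem_standardSubgroup {J : Finset B} {i : B} (hi : i ∈ J) :
    cs.simple i ∈ standardSubgroup cs J :=
  (simple_mem_standardSubgroup_iff cs).mpr hi

theorem standardSubgroup_mono {J K : Finset B} (h : J ⊆ K) :
    standardSubgroup cs J ≤ standardSubgroup cs K :=
  Subgroup.closure_mono (Set.image_mono (Finset.coe_subset.mpr h))

theorem invCocycle_eq_zero_of_notMem {J : Finset B} {u t : W} (hu : u ∈ standardSubgroup cs J)
    (ht : t ∉ standardSubgroup cs J) : invCocycle cs u t = 0 := by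
  have hconj {x t : W} (hx : x ∈ standardSubgroup cs J) (ht : t ∉ standardSubgroup cs J) :
      x * t * x⁻¹ ∉ standardSubgroup cs J := by
    rwa [Subgroup.mul_mem_cancel_right _ (inv_mem hx), Subgroup.mul_mem_cancel_left _ hx]
  induction hu using Subgroup.closure_induction generalizing t with
  | mem x hx =>
    classical
    obtain ⟨i, hi, rfl⟩ := hx
    rw [invCocycle_simple, if_neg]
    rintro rfl
    exact ht (simple_mem_standardSubgroup cs hi)
  | one => exact invCocycle_one cs t
  | mul x y _ hy ihx ihy =>
    rw [invCocycle_mul, ihy ht, ihx (hconj hy ht), add_zero]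
  | inv x hx ih =>
    have hinv := invCocycle_mul cs x x⁻¹ t
    rw [mul_inv_cancel, invCocycle_one, ih (hconj (inv_mem hx) ht), add_zero] at hinv
    exact hinv.symm

theorem mem_of_isRightDescent {J : Finset B} {u : W} (hu : u ∈ standardSubgroup cs J) {i : B}
    (hi : cs.IsRightDescent u i) : i ∈ J := by
  by_contra hiJ
  rw [isRightDescent_iff_invCocycle, invCocycle_eq_zero_of_notMem cs hu
    (mt (simple_mem_standardSubgroup_iff cs).mp hiJ)] at hi
  exact zero_ne_one hi

theorem eq_one_of_forall_not_isRightDescent {J : Finset B} {u : W}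
    (hu : u ∈ standardSubgroup cs J) (h : ∀ i ∈ J, ¬ cs.IsRightDescent u i) : u = 1 := by
  by_contra hne
  obtain ⟨i, hi⟩ := cs.exists_rightDescent_of_ne_one hne
  exact h i (mem_of_isRightDescent cs hu hi) hi

theorem eq_one_of_forall_mem_erase [DecidableEq B] {J : Finset B} {u : W}
    (hu : u ∈ standardSubgroup cs J) (h : ∀ i ∈ J, u ∈ standardSubgroup cs (J.erase i)) : u = 1 :=
  eq_one_of_forall_not_isRightDescent cs hu fun i hi hd =>
    Finset.notMem_erase i J (mem_of_isRightDescent cs (h i hi) hd)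

theorem invCocycle_eq_zero_of_forall_not_isRightDescent {J : Finset B} {w : W}
    (h : ∀ i ∈ J, ¬ cs.IsRightDescent w i) {t : W} (ht : t ∈ standardSubgroup cs J) :
    invCocycle cs w t = 0 := by
  obtain ⟨x, hx, hmin⟩ := exists_minimalFor_of_wellFoundedLT
    (fun x => x ∈ standardSubgroup cs J) (fun x => cs.length (w * x)) ⟨1, one_mem _⟩
  have hshortest {t : W} (ht : t ∈ standardSubgroup cs J) : invCocycle cs (w * x) t = 0 := by
    by_contra hne
    have hlt := (isRightInversion_of_invCocycle_ne_zero cs hne).2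
    rw [mul_assoc] at hlt
    exact hlt.not_ge (hmin (mul_mem hx ht) hlt.le)
  have hx1 : x⁻¹ = 1 := by
    refine eq_one_of_forall_not_isRightDescent cs (inv_mem hx) fun i hi hd => h i hi ?_
    rw [isRightDescent_iff_invCocycle] at hd ⊢
    rw [← mul_inv_cancel_right w x, invCocycle_mul, hd, hshortest, add_zero]
    exact mul_mem (mul_mem (inv_mem hx) (simple_mem_standardSubgroup cs hi))
      (inv_mem (inv_mem hx))
  rw [← mul_one w, ← inv_eq_one.mp hx1]
  exact hshortest ht

theorem length_mul_of_forall_not_isRightDescent {J : Finset B} {w : W}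
    (h : ∀ i ∈ J, ¬ cs.IsRightDescent w i) {u : W} (hu : u ∈ standardSubgroup cs J) :
    cs.length (w * u) = cs.length w + cs.length u := by
  induction hn : cs.length u using Nat.strong_induction_on generalizing u with
  | _ n ih =>
    subst hn
    rcases eq_or_ne u 1 with rfl | hu1
    · simp
    obtain ⟨i, hi⟩ := cs.exists_rightDescent_of_ne_one hu1
    have hiJ := simple_mem_standardSubgroup cs (mem_of_isRightDescent cs hu hi)
    obtain ⟨v, rfl⟩ : ∃ v, u = v * cs.simple i := ⟨u * cs.simple i, by simp⟩
    have hv := (Subgroup.mul_mem_cancel_right _ hiJ).mp hu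
    have hvi : ¬ cs.IsRightDescent v i := by
      rwa [cs.isRightDescent_iff_not_isRightDescent_mul, cs.simple_mul_simple_cancel_right] at hi
    have hwvi : ¬ cs.IsRightDescent (w * v) i := by
      rw [isRightDescent_iff_invCocycle] at hvi ⊢
      rwa [invCocycle_mul, invCocycle_eq_zero_of_forall_not_isRightDescent cs h
        (mul_mem (mul_mem hv hiJ) (inv_mem hv)), add_zero]
    rw [cs.not_isRightDescent_iff] at hvi hwvi
    rw [← mul_assoc, hwvi, hvi, ih _ (by omega) hv rfl, add_assoc]

theorem exists_forall_isRightInversion [Finite W] :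
    ∃ w₀ : W, ∀ t, cs.IsReflection t → cs.IsRightInversion w₀ t := by
  obtain ⟨w₀, hmax⟩ := Finite.exists_max cs.length
  exact ⟨w₀, fun t ht => ⟨ht, (hmax _).lt_of_ne (ht.length_mul_left_ne w₀)⟩⟩

theorem exists_isRightDescent_mul_iff [Finite W] :
    ∃ w₀ : W, ∀ w i, cs.IsRightDescent (w₀ * w) i ↔ ¬ cs.IsRightDescent w i := by
  obtain ⟨w₀, hw₀⟩ := exists_forall_isRightInversion cs
  refine ⟨w₀, fun w i => ?_⟩
  have hrefl := (cs.isReflection_simple i).conj w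
  rw [isRightDescent_iff_invCocycle, isRightDescent_iff_invCocycle, invCocycle_mul,
    (isRightInversion_iff_invCocycle cs hrefl).mp (hw₀ _ hrefl)]
  generalize invCocycle cs w (cs.simple i) = a
  revert a
  decide

theorem exists_descentNumber_mul [Fintype B] [Finite W] :
    ∃ w₀ : W, ∀ w, descentNumber cs (w₀ * w) + descentNumber cs w = Fintype.card B := by
  obtain ⟨w₀, hw₀⟩ := exists_isRightDescent_mul_iff cs
  refine ⟨w₀, fun w => ?_⟩
  rw [add_comm, ← Nat.card_eq_fintype_card, ← Set.ncard_add_ncard_compl {i | cs.IsRightDescent w i}]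
  simp only [descentNumber, hw₀, Set.compl_ofPred]

end Standard

/-! ### Dual codes and triangular families -/

section Dual

variable {ι : Type*} [Fintype ι]

theorem mem_dualCode {C : Submodule (ZMod 2) (ι → ZMod 2)} {y : ι → ZMod 2} :
    y ∈ dualCode C ↔ ∀ x ∈ C, x ⬝ᵥ y = 0 :=
  Iff.rfl

theorem dualCode_eq_orthogonal [DecidableEq ι] (C : Submodule (ZMod 2) (ι → ZMod 2)) :
    dualCode C = (Matrix.toBilin' (1 : Matrix ι ι (ZMod 2))).orthogonal C := by
  ext y
  simp [mem_dualCode, LinearMap.BilinForm.mem_orthogonal_iff, Matrix.toBilin'_apply']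

theorem toBilin'_one_nondegenerate {K : Type*} [Field K] [DecidableEq ι] :
    (Matrix.toBilin' (1 : Matrix ι ι K)).Nondegenerate :=
  LinearMap.BilinForm.nondegenerate_toBilin'_of_det_ne_zero' _ (by simp)

theorem toBilin'_one_isRefl {R : Type*} [CommRing R] [DecidableEq ι] :
    (Matrix.toBilin' (1 : Matrix ι ι R)).IsRefl := by
  intro x y h
  rw [Matrix.toBilin'_apply', Matrix.one_mulVec] at h ⊢
  rwa [dotProduct_comm]

theorem finrank_dualCode_add_finrank (C : Submodule (ZMod 2) (ι → ZMod 2)) :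
    Module.finrank (ZMod 2) (dualCode C) + Module.finrank (ZMod 2) C = Fintype.card ι := by
  classical
  rw [dualCode_eq_orthogonal, LinearMap.BilinForm.finrank_orthogonal toBilin'_one_nondegenerate,
    Nat.sub_add_cancel C.finrank_le, Module.finrank_fintype_fun_eq_card]

theorem dualCode_dualCode (C : Submodule (ZMod 2) (ι → ZMod 2)) : dualCode (dualCode C) = C := by
  classical
  rw [dualCode_eq_orthogonal, dualCode_eq_orthogonal,
    LinearMap.BilinForm.orthogonal_orthogonal toBilin'_one_nondegenerate toBilin'_one_isRefl]

end Dual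

theorem linearIndependent_of_triangular {κ ι K α : Type*} [Ring K] [NoZeroDivisors K]
    [LinearOrder α] {f : κ → ι → K} (pivot : κ → ι) (height : κ → α)
    (hdiag : ∀ v, f v (pivot v) ≠ 0)
    (htri : ∀ v w, f v (pivot w) ≠ 0 → v ≠ w → height v < height w) :
    LinearIndependent K f := by
  classical
  rw [linearIndependent_iff']
  intro s g hg i hi
  by_contra hgi
  obtain ⟨w, hw, hmin⟩ := Finset.exists_min_image (s.filter fun v => g v ≠ 0) height
    ⟨i, Finset.mem_filter.mpr ⟨hi, hgi⟩⟩
  obtain ⟨hws, hgw⟩ := Finset.mem_filter.mp hw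
  have hsum := congrFun hg (pivot w)
  rw [Finset.sum_apply, Finset.sum_eq_single_of_mem w hws] at hsum
  · exact mul_ne_zero hgw (hdiag w) hsum
  · intro v hv hvw
    by_contra hne
    rw [Pi.smul_apply, smul_eq_mul, mul_eq_zero, not_or] at hne
    exact (htri v w hne.2 hvw).not_ge (hmin v (Finset.mem_filter.mpr ⟨hv, hne.1⟩))

/-! ### Duality and dimension of Coxeter codes -/

section Codes

variable {B W : Type*} [Group W] {M : CoxeterMatrix B}

/-- The indicator word of the left coset `σ⟨J⟩`; these words generate the Coxeter codes. -/
noncomputable def cosetWord (cs : CoxeterSystem M W) (σ : W) (J : Finset B) : W → ZMod 2 :=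
  Set.indicator (σ • (standardSubgroup cs J : Set W)) 1

open scoped Classical in
theorem cosetWord_apply (cs : CoxeterSystem M W) (σ : W) (J : Finset B) (w : W) :
    cosetWord cs σ J w = if σ⁻¹ * w ∈ standardSubgroup cs J then 1 else 0 := by
  simp [cosetWord, Set.indicator_apply, Set.mem_smul_set_iff_inv_smul_mem]

theorem mem_span_indicator_smul {G R : Type*} [Group G] [Finite G] [Semiring R] (H : Subgroup G)
    {f : G → R} (hf : ∀ g, ∀ h ∈ H, f (g * h) = f g) :
    f ∈ Submodule.span R {u | ∃ τ : G, u = Set.indicator (τ • (H : Set G)) 1} := by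
  classical
  have := Fintype.ofFinite (G ⧸ H)
  have hmem (q : G ⧸ H) (g : G) : g ∈ q.out • (H : Set G) ↔ q = g := by
    rw [Set.mem_smul_set_iff_inv_smul_mem, smul_eq_mul, SetLike.mem_coe, ← QuotientGroup.eq,
      QuotientGroup.out_eq']
  have hsum : f = ∑ q : G ⧸ H, f q.out • Set.indicator (q.out • (H : Set G)) (1 : G → R) := by
    funext g
    obtain ⟨h, hh⟩ := QuotientGroup.mk_out_eq_mul H g
    simp [Set.indicator_apply, hmem, hh, hf g h h.2]
  rw [hsum]
  exact Submodule.sum_mem _ fun q _ => Submodule.smul_mem _ _ (Submodule.subset_span ⟨q.out, rfl⟩)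

variable (cs : CoxeterSystem M W)

theorem cosetWord_mul_of_mem {J : Finset B} {u : W} (hu : u ∈ standardSubgroup cs J) (σ w : W) :
    cosetWord cs σ J (w * u) = cosetWord cs σ J w := by
  rw [cosetWord_apply, cosetWord_apply, ← mul_assoc, Subgroup.mul_mem_cancel_right _ hu]

theorem cosetWord_dotProduct_cosetWord [Fintype W] {J K : Finset B} {i : B} (hJ : i ∈ J)
    (hK : i ∈ K) (σ τ : W) : cosetWord cs σ J ⬝ᵥ cosetWord cs τ K = 0 := by
  refine Finset.sum_involution (fun w _ => w * cs.simple i) ?_ ?_ (by simp) (by simp)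
  · intro w _
    rw [cosetWord_mul_of_mem cs (simple_mem_standardSubgroup cs hJ),
      cosetWord_mul_of_mem cs (simple_mem_standardSubgroup cs hK), CharTwo.add_self_eq_zero]
  · exact fun w _ _ h => cs.length_mul_simple_ne w i (congrArg cs.length h)

variable [Fintype B]

theorem cosetWord_mem_of_card_eq {r : ℤ} {J : Finset B}
    (hJ : (J.card : ℤ) = (Fintype.card B : ℤ) - r) (σ : W) :
    cosetWord cs σ J ∈ coxeterCode cs r :=
  Submodule.subset_span ⟨σ, J, hJ, rfl⟩

theorem cosetWord_mem [Finite W] {r : ℤ} (hr : r ≤ Fintype.card B) {J : Finset B}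
    (hJ : (Fintype.card B : ℤ) - r ≤ J.card) (σ : W) : cosetWord cs σ J ∈ coxeterCode cs r := by
  obtain ⟨K, hKJ, hK⟩ := Finset.exists_subset_card_eq
    (show ((Fintype.card B : ℤ) - r).toNat ≤ J.card by omega)
  refine Submodule.span_mono ?_ (mem_span_indicator_smul (standardSubgroup cs K)
    fun w u hu => cosetWord_mul_of_mem cs (standardSubgroup_mono cs hKJ hu) σ w)
  rintro _ ⟨τ, rfl⟩
  exact ⟨τ, K, by omega, rfl⟩

theorem coxeterCode_mono [Finite W] {q r : ℤ} (hqr : q ≤ r) (hr : r ≤ Fintype.card B) :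
    coxeterCode cs q ≤ coxeterCode cs r := by
  refine Submodule.span_le.mpr ?_
  rintro _ ⟨σ, J, hJ, rfl⟩
  exact cosetWord_mem cs hr (by omega) σ

theorem coxeterCode_le_dualCode [Fintype W] (r : ℤ) :
    coxeterCode cs ((Fintype.card B : ℤ) - r - 1) ≤ dualCode (coxeterCode cs r) := by
  classical
  refine Submodule.span_le.mpr ?_
  rintro _ ⟨τ, K, hK, rfl⟩ x hx
  induction hx using Submodule.span_induction with
  | mem x hx =>
    obtain ⟨σ, J, hJ, rfl⟩ := hx
    obtain ⟨i, hi⟩ : (J ∩ K).Nonempty := by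
      have := Finset.card_union_add_card_inter J K
      have := Finset.card_le_univ (J ∪ K)
      rw [← Finset.card_pos]
      omega
    obtain ⟨hiJ, hiK⟩ := Finset.mem_inter.mp hi
    exact cosetWord_dotProduct_cosetWord cs hiJ hiK σ τ
  | zero => exact zero_dotProduct _
  | add x y _ _ hx hy => rw [add_dotProduct, hx, hy, add_zero]
  | smul c x _ hx => rw [smul_dotProduct, hx, smul_zero]

open scoped Classical in
/-- The generators that are not descents of `w`. They generate the largest standard subgroup `⟨J⟩`
such that `w` is the shortest element of `w⟨J⟩`. -/
noncomputable def nonDescents (w : W) : Finset B :=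
  Finset.univ.filter fun i => ¬ cs.IsRightDescent w i

theorem mem_nonDescents {w : W} {i : B} : i ∈ nonDescents cs w ↔ ¬ cs.IsRightDescent w i := by
  simp [nonDescents]

theorem descentNumber_add_card_nonDescents (w : W) :
    descentNumber cs w + (nonDescents cs w).card = Fintype.card B := by
  rw [descentNumber, nonDescents, ← Set.ncard_coe_finset, Finset.coe_filter_univ,
    ← Nat.card_eq_fintype_card, ← Set.ncard_add_ncard_compl {i | cs.IsRightDescent w i},
    Set.compl_ofPred]

theorem ncard_descentNumber_le_add_ncard [Finite W] (r : ℤ) :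
    {w | (descentNumber cs w : ℤ) ≤ (Fintype.card B : ℤ) - r - 1}.ncard +
      {w | (descentNumber cs w : ℤ) ≤ r}.ncard = Nat.card W := by
  obtain ⟨w₀, hw₀⟩ := exists_descentNumber_mul cs
  have himage : {w | (descentNumber cs w : ℤ) ≤ (Fintype.card B : ℤ) - r - 1} =
      (w₀ * ·) ⁻¹' {w | (descentNumber cs w : ℤ) ≤ r}ᶜ := by
    ext w
    have := hw₀ w
    simp only [Set.mem_preimage, Set.mem_compl_iff, Set.mem_ofPred_eq]
    omega
  rw [himage, Set.ncard_preimage_of_injective_subset_range (mul_right_injective w₀)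
    (by rw [(Group.mulLeft_bijective w₀).surjective.range_eq]; exact Set.subset_univ _),
    add_comm, Set.ncard_add_ncard_compl]

theorem linearIndependent_cosetWord_nonDescents :
    LinearIndependent (ZMod 2) fun w => cosetWord cs w (nonDescents cs w) := by
  refine linearIndependent_of_triangular id cs.length (fun w => by simp [cosetWord_apply])
    fun v w hne hvw => ?_
  have hmem : v⁻¹ * w ∈ standardSubgroup cs (nonDescents cs v) := by
    by_contra hmem
    exact hne (by rw [cosetWord_apply, id, if_neg hmem])
  have hlen := length_mul_of_forall_not_isRightDescent cs
    (fun i hi => (mem_nonDescents cs).mp hi) hmem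
  have hpos : cs.length (v⁻¹ * w) ≠ 0 := fun h =>
    hvw (inv_mul_eq_one.mp (cs.length_eq_zero_iff.mp h))
  rw [mul_inv_cancel_left] at hlen
  omega

theorem ncard_le_finrank_coxeterCode [Finite W] {r : ℤ} (hr : r ≤ Fintype.card B) :
    {w | (descentNumber cs w : ℤ) ≤ r}.ncard ≤ Module.finrank (ZMod 2) (coxeterCode cs r) := by
  have := Fintype.ofFinite {w | (descentNumber cs w : ℤ) ≤ r}
  have hmem (w : {w | (descentNumber cs w : ℤ) ≤ r}) :
      cosetWord cs w.1 (nonDescents cs w.1) ∈ coxeterCode cs r := by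
    have hw : (descentNumber cs w.1 : ℤ) ≤ r := w.2
    have := descentNumber_add_card_nonDescents cs w.1
    exact cosetWord_mem cs hr (by omega) w.1
  have hind : LinearIndependent (ZMod 2) fun w => (⟨_, hmem w⟩ : coxeterCode cs r) :=
    .of_comp (coxeterCode cs r).subtype
      ((linearIndependent_cosetWord_nonDescents cs).comp _ Subtype.val_injective)
  rw [← Nat.card_coe_set_eq, Nat.card_eq_fintype_card]
  exact hind.fintype_card_le_finrank

theorem finrank_coxeterCode [Finite W] {r : ℤ} (h1 : -1 ≤ r) (h2 : r ≤ Fintype.card B) :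
    Module.finrank (ZMod 2) (coxeterCode cs r) = {w | (descentNumber cs w : ℤ) ≤ r}.ncard := by
  cases nonempty_fintype W
  have hle := ncard_le_finrank_coxeterCode cs h2
  have hle' := ncard_le_finrank_coxeterCode cs (r := (Fintype.card B : ℤ) - r - 1) (by omega)
  have hdual := Submodule.finrank_mono (coxeterCode_le_dualCode cs r)
  have hadd := finrank_dualCode_add_finrank (coxeterCode cs r)
  have hcard := ncard_descentNumber_le_add_ncard cs r
  rw [Nat.card_eq_fintype_card] at hcard
  omega

theorem dualCode_coxeterCode [Fintype W] {r : ℤ} (h1 : -1 ≤ r) (h2 : r ≤ Fintype.card B) :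
    dualCode (coxeterCode cs r) = coxeterCode cs ((Fintype.card B : ℤ) - r - 1) := by
  refine (Submodule.eq_of_le_of_finrank_eq (coxeterCode_le_dualCode cs r) ?_).symm
  have hadd := finrank_dualCode_add_finrank (coxeterCode cs r)
  have hcard := ncard_descentNumber_le_add_ncard cs r
  rw [finrank_coxeterCode cs h1 h2] at hadd
  rw [Nat.card_eq_fintype_card] at hcard
  rw [finrank_coxeterCode cs (by omega) (by omega)]
  omega

theorem finrank_coxeterCode_add_sum_eulerian [Finite W] {q r : ℤ} (hq : -1 ≤ q) (hqr : q ≤ r)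
    (hr : r ≤ Fintype.card B) :
    Module.finrank (ZMod 2) (coxeterCode cs q) + ∑ i ∈ Finset.Icc (q + 1) r, eulerian cs i.toNat =
      Module.finrank (ZMod 2) (coxeterCode cs r) := by
  induction r, hqr using Int.leInduction with
  | base => simp
  | succ r hqr ih =>
    have hunion : {w | (descentNumber cs w : ℤ) ≤ r + 1} =
        {w | (descentNumber cs w : ℤ) ≤ r} ∪ {w | descentNumber cs w = (r + 1).toNat} := by
      ext w
      simp only [Set.mem_ofPred_eq, Set.mem_union]
      omega
    have hdisj : Disjoint {w | (descentNumber cs w : ℤ) ≤ r}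
        {w | descentNumber cs w = (r + 1).toNat} := by
      rw [Set.disjoint_left]
      intro w
      simp only [Set.mem_ofPred_eq]
      omega
    rw [← Finset.insert_Icc_right_eq_Icc_add_one (by omega), Finset.sum_insert (by simp),
      add_left_comm, ih (by omega), finrank_coxeterCode cs (by omega) hr,
      finrank_coxeterCode cs (by omega) (by omega), hunion, Set.ncard_union_eq hdisj, eulerian,
      add_comm]

end Codes

/-! ### Minimum weight of Coxeter codes -/

open scoped IsMulCommutative in
theorem card_closure_dvd_pow_card {G : Type*} [Group G] {n : ℕ} (s : Finset G)
    (hcomm : ∀ a ∈ s, ∀ b ∈ s, Commute a b) (hpow : ∀ a ∈ s, a ^ n = 1) :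
    Nat.card (Subgroup.closure (s : Set G)) ∣ n ^ s.card := by
  have := Subgroup.isMulCommutative_closure hcomm
  have htop : ⊤ ≤ (powMonoidHom n : Subgroup.closure (s : Set G) →* _).ker := by
    rw [← Subgroup.closure_preimage_eq_top (s : Set G), Subgroup.closure_le]
    exact fun a ha => Subtype.ext (hpow a ha)
  exact (card_dvd_exponent_pow_rank' _ fun g => htop (Subgroup.mem_top g)).trans
    (pow_dvd_pow n (Subgroup.rank_closure_finset_le_card s))

section MinimumWeight

variable {B W : Type*} [Group W] {M : CoxeterMatrix B} (cs : CoxeterSystem M W)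

theorem simple_commute_of_eq_two {i j : B} (h : M i j = 2) :
    Commute (cs.simple i) (cs.simple j) := by
  have hmul : cs.simple i * cs.simple j * (cs.simple i * cs.simple j) = 1 := by
    rw [← pow_two, ← h, cs.simple_mul_simple_pow]
  rw [Commute, SemiconjBy, eq_inv_of_mul_eq_one_left hmul, mul_inv_rev, cs.inv_simple,
    cs.inv_simple]

theorem card_standardSubgroup_le {I : Finset B}
    (hI : (I : Set B).Pairwise fun i j => M i j = 2) :
    Nat.card (standardSubgroup cs I) ≤ 2 ^ I.card := by
  classical
  have hdvd := card_closure_dvd_pow_card (n := 2) (I.image cs.simple)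
    (by
      simp only [Finset.forall_mem_image]
      intro i hi j hj
      rcases eq_or_ne i j with rfl | hij
      · exact Commute.refl _
      · exact simple_commute_of_eq_two cs (hI hi hj hij))
    (by simp)
  rw [Finset.coe_image] at hdvd
  exact (Nat.le_of_dvd (by positivity) hdvd).trans
    (Nat.pow_le_pow_right two_pos Finset.card_image_le)

variable [Fintype W]

theorem exists_ne_zero_of_cosetWord_dotProduct_eq_zero [DecidableEq B] {J : Finset B} {k : ℕ}
    (hk : k ≤ J.card) {f : W → ZMod 2} {σ : W} (hσ : f σ ≠ 0)
    (horth : ∀ K ⊆ J, K.card = k → cosetWord cs σ K ⬝ᵥ f = 0) :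
    ∃ i ∈ J, ∃ b, f b ≠ 0 ∧ σ⁻¹ * b ∈ standardSubgroup cs J ∧
      σ⁻¹ * b ∉ standardSubgroup cs (J.erase i) := by
  by_contra! hsep
  have hunique (b : W) (hb : σ⁻¹ * b ∈ standardSubgroup cs J) (hbσ : b ≠ σ) : f b = 0 := by
    by_contra hfb
    exact hbσ (inv_mul_eq_one.mp
      (eq_one_of_forall_mem_erase cs hb fun i hi => hsep i hi b hfb hb)).symm
  obtain ⟨K, hKJ, hK⟩ := Finset.exists_subset_card_eq hk
  refine hσ ?_
  rw [← horth K hKJ hK, dotProduct, Finset.sum_eq_single σ _ (by simp)]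
  · simp [cosetWord_apply]
  · intro b _ hbσ
    by_cases hb : σ⁻¹ * b ∈ standardSubgroup cs K
    · rw [hunique b (standardSubgroup_mono cs hKJ hb) hbσ, mul_zero]
    · rw [cosetWord_apply, if_neg hb, zero_mul]

/-- The coset `σ⟨J⟩` contains two disjoint cosets of `⟨J.erase i⟩` that meet the support of `f`. -/
theorem two_pow_le_ncard_coset_inter_support {k : ℕ} {f : W → ZMod 2} (J : Finset B)
    (horth : ∀ K ⊆ J, K.card = k → ∀ τ, cosetWord cs τ K ⬝ᵥ f = 0) {σ : W} (hσ : f σ ≠ 0) :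
    2 ^ (J.card + 1 - k) ≤ {w | σ⁻¹ * w ∈ standardSubgroup cs J ∧ f w ≠ 0}.ncard := by
  classical
  induction J using Finset.strongInduction generalizing σ with
  | H J ih =>
    rcases lt_or_ge J.card k with hk | hk
    · rw [show J.card + 1 - k = 0 by omega, pow_zero, Nat.one_le_iff_ne_zero,
        ← Nat.pos_iff_ne_zero, Set.ncard_pos]
      exact ⟨σ, by simp, hσ⟩
    obtain ⟨i, hi, b, hfb, hbJ, hbi⟩ := exists_ne_zero_of_cosetWord_dotProduct_eq_zero cs hk hσ
      fun K hKJ hK => horth K hKJ hK σ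
    set S : W → Set W := fun τ => {w | τ⁻¹ * w ∈ standardSubgroup cs (J.erase i) ∧ f w ≠ 0}
    have hhalf {τ : W} (hτ : f τ ≠ 0) : 2 ^ (J.card - k) ≤ (S τ).ncard := by
      have := ih (J.erase i) (Finset.erase_ssubset hi)
        (fun K hK => horth K (hK.trans (Finset.erase_subset i J))) hτ
      rwa [Finset.card_erase_add_one hi] at this
    have hdisj : Disjoint (S σ) (S b) := by
      refine Set.disjoint_left.mpr fun w hσw hbw => hbi ?_
      simpa [mul_assoc] using mul_mem hσw.1 (inv_mem hbw.1)
    have hsub : S σ ∪ S b ⊆ {w | σ⁻¹ * w ∈ standardSubgroup cs J ∧ f w ≠ 0} := by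
      have hmono := standardSubgroup_mono cs (Finset.erase_subset i J)
      rintro w (⟨hw, hfw⟩ | ⟨hw, hfw⟩)
      · exact ⟨hmono hw, hfw⟩
      · exact ⟨by simpa [mul_assoc] using mul_mem hbJ (hmono hw), hfw⟩
    calc 2 ^ (J.card + 1 - k) = 2 ^ (J.card - k) + 2 ^ (J.card - k) := by
          rw [Nat.sub_add_comm hk, pow_succ, mul_two]
      _ ≤ (S σ).ncard + (S b).ncard := Nat.add_le_add (hhalf hσ) (hhalf hfb)
      _ = (S σ ∪ S b).ncard := (Set.ncard_union_eq hdisj).symm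
      _ ≤ _ := Set.ncard_le_ncard hsub

theorem hammingNorm_cosetWord (σ : W) (J : Finset B) :
    hammingNorm (cosetWord cs σ J) = Nat.card (standardSubgroup cs J) := by
  classical
  rw [← SetLike.coe_sort_coe, Nat.card_coe_set_eq, ← Set.ncard_smul_set σ, hammingNorm,
    ← Set.ncard_coe_finset]
  congr 1
  ext w
  simp [cosetWord_apply, Set.mem_smul_set_iff_inv_smul_mem]

variable [Fintype B]

theorem two_pow_le_hammingNorm {r : ℤ} (hr : -1 ≤ r) {f : W → ZMod 2}
    (hf : f ∈ coxeterCode cs r) (hf0 : f ≠ 0) :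
    2 ^ ((Fintype.card B : ℤ) - r).toNat ≤ hammingNorm f := by
  obtain ⟨σ, hσ⟩ := Function.ne_iff.mp hf0
  have hbound := two_pow_le_ncard_coset_inter_support cs (k := (r + 1).toNat) Finset.univ
    (fun K _ hK τ => by
      rw [dotProduct_comm]
      exact coxeterCode_le_dualCode cs r (cosetWord_mem_of_card_eq cs (by omega) τ) f hf) hσ
  rw [Finset.card_univ, show Fintype.card B + 1 - (r + 1).toNat =
    ((Fintype.card B : ℤ) - r).toNat by omega] at hbound
  rw [hammingNorm, ← Set.ncard_coe_finset]
  refine hbound.trans (Set.ncard_le_ncard fun w hw => ?_)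
  simpa using hw.2

theorem exists_hammingNorm_eq_two_pow {r : ℤ} (hr : r ≤ Fintype.card B)
    (hrB : (Fintype.card B : ℤ) ≤ 2 * r) :
    ∃ f ∈ coxeterCode cs r, f ∉ coxeterCode cs (r - 1) ∧
      hammingNorm f = 2 ^ ((Fintype.card B : ℤ) - r).toNat := by
  obtain ⟨I₀, hcard, hI₀⟩ := exists_pairwise_eq_two cs
  obtain ⟨I, hI, hIcard⟩ := Finset.exists_subset_card_eq
    (show ((Fintype.card B : ℤ) - r).toNat ≤ I₀.card by omega)
  have hmem := cosetWord_mem_of_card_eq cs (r := r) (J := I) (by omega) 1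
  have hne : cosetWord cs 1 I ≠ 0 := fun h => by simpa [cosetWord_apply] using congrFun h 1
  have hupper := card_standardSubgroup_le cs (hI₀.mono (Finset.coe_subset.mpr hI))
  rw [← hammingNorm_cosetWord cs 1, hIcard] at hupper
  refine ⟨_, hmem, fun hmem' => ?_, hupper.antisymm (two_pow_le_hammingNorm cs (by omega) hmem hne)⟩
  have hlower := two_pow_le_hammingNorm cs (by omega) hmem' hne
  exact (hlower.trans hupper).not_gt (Nat.pow_lt_pow_right one_lt_two (by omega))

end MinimumWeight

/-! ### Pauli operators -/

section Pauli

variable {ι : Type*}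

/-- Labels of computational basis states, as binary vectors. -/
def bits : (ι → Fin 2) ≃ (ι → ZMod 2) :=
  Equiv.piCongrRight fun _ => (ZMod.finEquiv 2).toEquiv

theorem bits_apply (a : ι → Fin 2) (i : ι) : bits a i = ZMod.finEquiv 2 (a i) :=
  rfl

theorem stdAddChar_one_eq_neg_one : ZMod.stdAddChar (1 : ZMod 2) = -1 := by
  have h := ZMod.stdAddChar_coe (N := 2) 1
  rw [Int.cast_one] at h
  rw [h, ← Complex.exp_pi_mul_I]
  congr 1
  push_cast
  ring

theorem pauliX_pow_apply (x : ZMod 2) (a b : Fin 2) :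
    (pauliX ^ x.val) a b = if ZMod.finEquiv 2 a = ZMod.finEquiv 2 b + x then 1 else 0 := by
  obtain rfl | rfl : x = 0 ∨ x = 1 := by revert x; decide
  all_goals fin_cases a <;> fin_cases b <;>
    simp [pauliX, ZMod.val_one, CharTwo.add_self_eq_zero]

theorem pauliZ_pow_apply (z : ZMod 2) (a b : Fin 2) :
    (pauliZ ^ z.val) a b = if a = b then ZMod.stdAddChar (z * ZMod.finEquiv 2 b) else 0 := by
  obtain rfl | rfl : z = 0 ∨ z = 1 := by revert z; decide
  all_goals fin_cases a <;> fin_cases b <;>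
    simp [pauliZ, ZMod.val_one, stdAddChar_one_eq_neg_one]

theorem addChar_sum_eq_prod {A M κ : Type*} [AddCommMonoid A] [CommMonoid M] (χ : AddChar A M)
    (s : Finset κ) (f : κ → A) : χ (∑ i ∈ s, f i) = ∏ i ∈ s, χ (f i) :=
  map_prod χ.toMonoidHom (fun i => Multiplicative.ofAdd (f i)) s

variable [Fintype ι]

theorem xOp_apply (x : ι → ZMod 2) (a b : ι → Fin 2) :
    xOp x a b = if bits a = bits b + x then 1 else 0 := by
  simp only [xOp, tensorOp, Matrix.of_apply, pauliX_pow_apply, funext_iff, Pi.add_apply,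
    bits_apply, Fintype.prod_boole]

theorem zOp_apply (z : ι → ZMod 2) (a b : ι → Fin 2) :
    zOp z a b = if a = b then ZMod.stdAddChar (z ⬝ᵥ bits b) else 0 := by
  simp only [zOp, tensorOp, Matrix.of_apply, pauliZ_pow_apply, Fintype.prod_ite_zero, funext_iff,
    dotProduct, addChar_sum_eq_prod, bits_apply]

variable [DecidableEq ι]

theorem pauli_apply (x z : ι → ZMod 2) (a b : ι → Fin 2) :
    pauli x z a b = if bits a = bits b + x then ZMod.stdAddChar (z ⬝ᵥ bits b) else 0 := by
  simp [pauli, Matrix.mul_apply, xOp_apply, zOp_apply]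

theorem pauli_zero_right (x : ι → ZMod 2) : pauli x 0 = xOp x := by
  ext a b
  simp [pauli_apply, xOp_apply]

theorem pauli_zero_left (z : ι → ZMod 2) : pauli 0 z = zOp z := by
  ext a b
  simp [pauli_apply, zOp_apply, bits.injective.eq_iff]

theorem pauli_zero_zero : pauli (0 : ι → ZMod 2) 0 = 1 := by
  ext a b
  simp [pauli_apply, Matrix.one_apply, bits.injective.eq_iff]

theorem pauli_mulVec (x z : ι → ZMod 2) (ψ : (ι → Fin 2) → ℂ) (b : ι → ZMod 2) :
    (pauli x z).mulVec ψ (bits.symm (b + x)) =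
      ZMod.stdAddChar (z ⬝ᵥ b) * ψ (bits.symm b) := by
  rw [Matrix.mulVec, dotProduct, ← Equiv.sum_comp bits.symm]
  simp [pauli_apply]

theorem pauli_mul_pauli (x z x' z' : ι → ZMod 2) :
    pauli x z * pauli x' z' = ZMod.stdAddChar (z ⬝ᵥ x') • pauli (x + x') (z + z') := by
  ext a b
  rw [Matrix.mul_apply, ← Equiv.sum_comp bits.symm]
  simp only [pauli_apply, Equiv.apply_symm_apply, mul_ite, mul_zero, Finset.sum_ite_eq',
    Finset.mem_univ, if_true, Matrix.smul_apply, smul_eq_mul, add_dotProduct, dotProduct_add,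
    AddChar.map_add_eq_mul, add_assoc, add_comm x']
  split_ifs <;> ring

theorem smul_pauli_injective {c c' : ℂ} (hc : c ≠ 0) {x z x' z' : ι → ZMod 2}
    (h : c • pauli x z = c' • pauli x' z') : x = x' ∧ z = z' ∧ c = c' := by
  have hentry (b : ι → ZMod 2) : c * ZMod.stdAddChar (z ⬝ᵥ b) =
      if x = x' then c' * ZMod.stdAddChar (z' ⬝ᵥ b) else 0 := by
    simpa [pauli_apply] using congrFun (congrFun h (bits.symm (b + x))) (bits.symm b)
  obtain rfl : x = x' := by
    by_contra hne
    simpa [hne, hc] using hentry 0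
  simp only [if_true] at hentry
  obtain rfl : c = c' := by simpa using hentry 0
  refine ⟨rfl, funext fun i => ?_, rfl⟩
  simpa using ZMod.injective_stdAddChar (mul_left_cancel₀ hc (hentry (Pi.single i 1)))

theorem pauli_commute_iff (x z x' z' : ι → ZMod 2) :
    Commute (pauli x z) (pauli x' z') ↔ z ⬝ᵥ x' = z' ⬝ᵥ x := by
  rw [Commute, SemiconjBy, pauli_mul_pauli, pauli_mul_pauli, add_comm x' x, add_comm z' z]
  exact ⟨fun h => ZMod.injective_stdAddChar
    (smul_pauli_injective (AddChar.val_isUnit _ _).ne_zero h).2.2, fun h => by rw [h]⟩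

end Pauli

/-! ### CSS codes -/

section CSS

variable {ι : Type*}

/-- The states whose amplitudes are supported on `C` and constant on the cosets of `D` in `C`,
parametrized by the amplitude on each coset. -/
noncomputable def cosetState (D C : Submodule (ZMod 2) (ι → ZMod 2)) :
    ((C ⧸ D.submoduleOf C) → ℂ) →ₗ[ℂ] ((ι → Fin 2) → ℂ) :=
  Function.ExtendByZero.linearMap ℂ (fun c : C => bits.symm (c : ι → ZMod 2)) ∘ₗ
    LinearMap.funLeft ℂ ℂ (D.submoduleOf C).mkQ

section CosetState

variable {D C : Submodule (ZMod 2) (ι → ZMod 2)}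

theorem cosetState_apply_coe (φ : C ⧸ D.submoduleOf C → ℂ) (c : C) :
    cosetState D C φ (bits.symm (c : ι → ZMod 2)) = φ ((D.submoduleOf C).mkQ c) :=
  (bits.symm.injective.comp Subtype.val_injective).extend_apply _ _ c

theorem cosetState_apply_of_notMem (φ : C ⧸ D.submoduleOf C → ℂ) {b : ι → ZMod 2} (hb : b ∉ C) :
    cosetState D C φ (bits.symm b) = 0 :=
  Function.extend_apply' _ _ _ fun ⟨c, hc⟩ => hb (bits.symm.injective hc ▸ c.2)

theorem cosetState_injective : Function.Injective (cosetState D C) := fun φ φ' h => by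
  funext k
  obtain ⟨c, rfl⟩ := (D.submoduleOf C).mkQ_surjective k
  rw [← cosetState_apply_coe φ, h, cosetState_apply_coe φ']

theorem mem_range_cosetState_iff (hDC : D ≤ C) {ψ : (ι → Fin 2) → ℂ} :
    ψ ∈ LinearMap.range (cosetState D C) ↔
      (∀ b, ∀ x ∈ D, ψ (bits.symm (b + x)) = ψ (bits.symm b)) ∧
        ∀ b, b ∉ C → ψ (bits.symm b) = 0 := by
  constructor
  · rintro ⟨φ, rfl⟩
    refine ⟨fun b x hx => ?_, fun b hb => cosetState_apply_of_notMem φ hb⟩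
    by_cases hb : b ∈ C
    · have hclass : (D.submoduleOf C).mkQ (⟨b, hb⟩ + ⟨x, hDC hx⟩) =
          (D.submoduleOf C).mkQ ⟨b, hb⟩ := by
        rw [map_add, add_eq_left]
        exact (Submodule.Quotient.mk_eq_zero _).mpr hx
      exact (cosetState_apply_coe φ (⟨b, hb⟩ + ⟨x, hDC hx⟩)).trans
        ((congrArg φ hclass).trans (cosetState_apply_coe φ ⟨b, hb⟩).symm)
    · rw [cosetState_apply_of_notMem φ hb,
        cosetState_apply_of_notMem φ (by rwa [C.add_mem_iff_left (hDC hx)])]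
  · rintro ⟨hinv, hsupp⟩
    refine ⟨fun k => ψ (bits.symm (k.out : C)), ?_⟩
    funext a
    obtain ⟨b, rfl⟩ := bits.symm.surjective a
    by_cases hb : b ∈ C
    · set c : C := Quotient.out ((D.submoduleOf C).mkQ ⟨b, hb⟩) with hc
      have hdiff : (c : ι → ZMod 2) - b ∈ D :=
        (Submodule.Quotient.eq (D.submoduleOf C)).mp
          (Quotient.out_eq ((D.submoduleOf C).mkQ ⟨b, hb⟩))
      rw [cosetState_apply_coe _ (⟨b, hb⟩ : C), ← hc, ← hinv b _ hdiff, add_sub_cancel]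
    · rw [cosetState_apply_of_notMem _ hb, hsupp b hb]

end CosetState

variable [Fintype ι]

theorem hammingNorm_le_pauliWeight_left (x z : ι → ZMod 2) : hammingNorm x ≤ pauliWeight x z :=
  Finset.card_le_card (Finset.monotone_filter_right _ fun _ _ hi => Or.inl hi)

theorem hammingNorm_le_pauliWeight_right (x z : ι → ZMod 2) : hammingNorm z ≤ pauliWeight x z :=
  Finset.card_le_card (Finset.monotone_filter_right _ fun _ _ hi => Or.inr hi)

theorem pauliWeight_zero_right (x : ι → ZMod 2) : pauliWeight x 0 = hammingNorm x := by
  simp [pauliWeight, hammingNorm]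

theorem pauliWeight_zero_left (z : ι → ZMod 2) : pauliWeight 0 z = hammingNorm z := by
  simp [pauliWeight, hammingNorm]

variable [DecidableEq ι] {C₁ C₂ : Submodule (ZMod 2) (ι → ZMod 2)}

theorem mem_css_iff (h : dualCode C₁ ≤ C₂) {s : Op ι} :
    s ∈ css C₁ C₂ ↔ ∃ x ∈ dualCode C₁, ∃ z ∈ dualCode C₂, s = pauli x z := by
  constructor
  · intro hs
    induction hs using Submonoid.closure_induction with
    | mem s hs =>
      rcases hs with ⟨x, hx, rfl⟩ | ⟨z, hz, rfl⟩
      · exact ⟨x, hx, 0, zero_mem _, (pauli_zero_right x).symm⟩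
      · exact ⟨0, zero_mem _, z, hz, (pauli_zero_left z).symm⟩
    | one => exact ⟨0, zero_mem _, 0, zero_mem _, pauli_zero_zero.symm⟩
    | mul s t _ _ hs ht =>
      obtain ⟨x, hx, z, hz, rfl⟩ := hs
      obtain ⟨x', hx', z', hz', rfl⟩ := ht
      refine ⟨x + x', add_mem hx hx', z + z', add_mem hz hz', ?_⟩
      rw [pauli_mul_pauli, dotProduct_comm, hz x' (h hx'), AddChar.map_zero_eq_one, one_smul]
  · rintro ⟨x, hx, z, hz, rfl⟩
    exact mul_mem (Submonoid.subset_closure (Or.inl ⟨x, hx, rfl⟩))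
      (Submonoid.subset_closure (Or.inr ⟨z, hz, rfl⟩))

theorem isStabilizerGroup_css (h : dualCode C₁ ≤ C₂) : IsStabilizerGroup (css C₁ C₂) where
  isPauli s hs := by
    obtain ⟨x, -, z, -, rfl⟩ := (mem_css_iff h).mp hs
    exact ⟨1, x, z, one_pow 4, (one_smul _ _).symm⟩
  commute s hs t ht := by
    obtain ⟨x, hx, z, hz, rfl⟩ := (mem_css_iff h).mp hs
    obtain ⟨x', hx', z', hz', rfl⟩ := (mem_css_iff h).mp ht
    rw [pauli_commute_iff, dotProduct_comm, hz x' (h hx'), dotProduct_comm, hz' x (h hx)]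
  neg_one_notMem hs := by
    obtain ⟨x, -, z, -, hxz⟩ := (mem_css_iff h).mp hs
    have hphase : (1 : ℂ) • pauli x z = (-1 : ℂ) • pauli (0 : ι → ZMod 2) 0 := by
      rw [pauli_zero_zero, one_smul, ← hxz, neg_one_smul]
    have := (smul_pauli_injective one_ne_zero hphase).2.2
    norm_num at this

theorem forall_mem_css_commute_pauli_iff (h : dualCode C₁ ≤ C₂) {x z : ι → ZMod 2} :
    (∀ s ∈ css C₁ C₂, Commute s (pauli x z)) ↔ x ∈ C₂ ∧ z ∈ C₁ := by
  constructor
  · refine fun hs => ⟨?_, ?_⟩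
    · rw [← dualCode_dualCode C₂]
      intro z' hz'
      simpa using (pauli_commute_iff 0 z' x z).mp
        (hs _ ((mem_css_iff h).mpr ⟨0, zero_mem _, z', hz', rfl⟩))
    · rw [← dualCode_dualCode C₁]
      intro x' hx'
      simpa [dotProduct_comm, eq_comm] using (pauli_commute_iff x' 0 x z).mp
        (hs _ ((mem_css_iff h).mpr ⟨x', hx', 0, zero_mem _, rfl⟩))
  · rintro ⟨hx, hz⟩ s hs
    obtain ⟨x', hx', z', hz', rfl⟩ := (mem_css_iff h).mp hs
    rw [pauli_commute_iff, dotProduct_comm, hz' x hx, hx' z hz]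

theorem exists_smul_pauli_mem_css_iff (h : dualCode C₁ ≤ C₂) {x z : ι → ZMod 2} :
    (∃ c : ℂ, c • pauli x z ∈ css C₁ C₂) ↔ x ∈ dualCode C₁ ∧ z ∈ dualCode C₂ := by
  constructor
  · rintro ⟨c, hc⟩
    obtain ⟨x', hx', z', hz', hc⟩ := (mem_css_iff h).mp hc
    obtain ⟨rfl, rfl, -⟩ := smul_pauli_injective one_ne_zero ((one_smul ℂ _).trans hc.symm)
    exact ⟨hx', hz'⟩
  · rintro ⟨hx, hz⟩
    exact ⟨1, (one_smul ℂ (pauli x z)).symm ▸ (mem_css_iff h).mpr ⟨x, hx, z, hz, rfl⟩⟩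

theorem mem_logicalWeights_css_iff (h : dualCode C₁ ≤ C₂) {w : ℕ} :
    w ∈ logicalWeights (css C₁ C₂) ↔ ∃ x ∈ C₂, ∃ z ∈ C₁,
      (x ∉ dualCode C₁ ∨ z ∉ dualCode C₂) ∧ w = pauliWeight x z := by
  simp only [logicalWeights, Set.mem_ofPred_eq, forall_mem_css_commute_pauli_iff h,
    ← not_exists, exists_smul_pauli_mem_css_iff h, not_and_or]
  exact ⟨fun ⟨x, z, ⟨hx, hz⟩, hxz⟩ => ⟨x, hx, z, hz, hxz⟩,
    fun ⟨x, hx, z, hz, hxz⟩ => ⟨x, z, ⟨hx, hz⟩, hxz⟩⟩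

theorem hasDistance_css (h : dualCode C₁ ≤ C₂) {d : ℕ}
    (hd : IsLeast (hammingNorm '' ((C₂ : Set (ι → ZMod 2)) \ dualCode C₁ ∪
      (C₁ : Set (ι → ZMod 2)) \ dualCode C₂)) d) :
    HasDistance (css C₁ C₂) d := by
  obtain ⟨⟨f, hf, rfl⟩, hmin⟩ := hd
  refine ⟨(mem_logicalWeights_css_iff h).mpr ?_, fun w hw => ?_⟩
  · rcases hf with ⟨hf, hf'⟩ | ⟨hf, hf'⟩
    · exact ⟨f, hf, 0, zero_mem _, Or.inl hf', (pauliWeight_zero_right f).symm⟩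
    · exact ⟨0, zero_mem _, f, hf, Or.inr hf', (pauliWeight_zero_left f).symm⟩
  · obtain ⟨x, hx, z, hz, hx' | hz', rfl⟩ := (mem_logicalWeights_css_iff h).mp hw
    · exact (hmin ⟨x, Or.inl ⟨hx, hx'⟩, rfl⟩).trans (hammingNorm_le_pauliWeight_left x z)
    · exact (hmin ⟨z, Or.inr ⟨hz, hz'⟩, rfl⟩).trans (hammingNorm_le_pauliWeight_right x z)

theorem mem_codeSpace_css_iff (h : dualCode C₁ ≤ C₂) {ψ : (ι → Fin 2) → ℂ} :
    ψ ∈ codeSpace (css C₁ C₂) ↔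
      (∀ b, ∀ x ∈ dualCode C₁, ψ (bits.symm (b + x)) = ψ (bits.symm b)) ∧
        ∀ b, b ∉ C₂ → ψ (bits.symm b) = 0 := by
  constructor
  · refine fun hψ => ⟨fun b x hx => ?_, fun b hb => ?_⟩
    · have hfix := pauli_mulVec x 0 ψ b
      rwa [hψ _ ((mem_css_iff h).mpr ⟨x, hx, 0, zero_mem _, rfl⟩), zero_dotProduct,
        AddChar.map_zero_eq_one, one_mul] at hfix
    · rw [← dualCode_dualCode C₂, mem_dualCode] at hb
      push Not at hb
      obtain ⟨z, hz, hzb⟩ := hb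
      have hone : z ⬝ᵥ b = 1 := Fin.eq_one_of_ne_zero _ hzb
      have hneg := pauli_mulVec 0 z ψ b
      rw [hψ _ ((mem_css_iff h).mpr ⟨0, zero_mem _, z, hz, rfl⟩), add_zero,
        hone, stdAddChar_one_eq_neg_one, neg_one_mul] at hneg
      exact self_eq_neg.mp hneg
  · rintro ⟨hinv, hsupp⟩ s hs
    obtain ⟨x, hx, z, hz, rfl⟩ := (mem_css_iff h).mp hs
    funext a
    obtain ⟨b, rfl⟩ : ∃ b, a = bits.symm (b + x) := ⟨bits a - x, by simp⟩
    rw [pauli_mulVec, hinv b x hx]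
    by_cases hb : b ∈ C₂
    · rw [dotProduct_comm, hz b hb, AddChar.map_zero_eq_one, one_mul]
    · rw [hsupp b hb, mul_zero]

theorem codeSpace_css (h : dualCode C₁ ≤ C₂) :
    codeSpace (css C₁ C₂) = LinearMap.range (cosetState (dualCode C₁) C₂) :=
  Submodule.ext fun _ => (mem_codeSpace_css_iff h).trans (mem_range_cosetState_iff h).symm

theorem finrank_codeSpace_css (h : dualCode C₁ ≤ C₂) :
    Module.finrank ℂ (codeSpace (css C₁ C₂)) =
      2 ^ (Module.finrank (ZMod 2) C₂ - Module.finrank (ZMod 2) (dualCode C₁)) := by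
  classical
  have := Fintype.ofFinite (C₂ ⧸ (dualCode C₁).submoduleOf C₂)
  rw [codeSpace_css h, LinearMap.finrank_range_of_inj cosetState_injective,
    Module.finrank_fintype_fun_eq_card, Module.card_eq_pow_finrank (K := ZMod 2), ZMod.card,
    ← (Submodule.submoduleOfEquivOfLe h).finrank_eq,
    ← Submodule.finrank_quotient_add_finrank ((dualCode C₁).submoduleOf C₂), Nat.add_sub_cancel]

end CSS

/-! ### Quantum Coxeter codes -/

section QuantumCoxeter

variable {B W : Type*} [Fintype B] [Group W] [Fintype W] {M : CoxeterMatrix B}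
  (cs : CoxeterSystem M W) {q r : ℤ}

theorem isLeast_hammingNorm_coxeterCode_diff (hq : -1 ≤ q) (hqr : q < r)
    (hr : r ≤ Fintype.card B) :
    IsLeast (hammingNorm '' ((coxeterCode cs r : Set (W → ZMod 2)) \ coxeterCode cs q ∪
        (coxeterCode cs ((Fintype.card B : ℤ) - q - 1) : Set (W → ZMod 2)) \
          coxeterCode cs ((Fintype.card B : ℤ) - r - 1)))
      (2 ^ (min (q + 1) ((Fintype.card B : ℤ) - r)).toNat) := by
  refine ⟨?_, ?_⟩
  · rcases le_total (q + 1) ((Fintype.card B : ℤ) - r) with hmin | hmin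
    · obtain ⟨f, hf, hf', hnorm⟩ :=
        exists_hammingNorm_eq_two_pow cs (r := (Fintype.card B : ℤ) - q - 1) (by omega) (by omega)
      refine ⟨f, Or.inr ⟨hf, fun h => hf' (coxeterCode_mono cs (by omega) (by omega) h)⟩, ?_⟩
      rw [hnorm, min_eq_left hmin]
      congr 2
      omega
    · obtain ⟨f, hf, hf', hnorm⟩ := exists_hammingNorm_eq_two_pow cs hr (by omega)
      refine ⟨f, Or.inl ⟨hf, fun h => hf' (coxeterCode_mono cs (by omega) (by omega) h)⟩, ?_⟩
      rw [hnorm, min_eq_right hmin]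
  · rintro _ ⟨f, ⟨hf, hf'⟩ | ⟨hf, hf'⟩, rfl⟩
    · exact (Nat.pow_le_pow_right two_pos (by omega)).trans
        (two_pow_le_hammingNorm cs (by omega) hf (ne_of_mem_of_not_mem (zero_mem _) hf').symm)
    · exact (Nat.pow_le_pow_right two_pos (by omega)).trans
        (two_pow_le_hammingNorm cs (by omega) hf (ne_of_mem_of_not_mem (zero_mem _) hf').symm)

end QuantumCoxeter

end QCoxeter

theorem mainTheorem9 {B W : Type*} [Fintype B] [Group W] [Fintype W] [DecidableEq W]
    {M : CoxeterMatrix B} (cs : CoxeterSystem M W) (q r : ℤ)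
    (hq : -1 ≤ q) (hqr : q ≤ r) (hr : r ≤ (Fintype.card B : ℤ)) :
    QCoxeter.dualCode (QCoxeter.coxeterCode cs ((Fintype.card B : ℤ) - q - 1)) ≤
        QCoxeter.coxeterCode cs r ∧
      QCoxeter.IsCode (QCoxeter.quantumCoxeter cs q r) (Fintype.card W)
        (∑ i ∈ Finset.Icc (q + 1) r, QCoxeter.eulerian cs i.toNat) ∧
      (q < r → QCoxeter.HasDistance (QCoxeter.quantumCoxeter cs q r)
        (2 ^ (min (q + 1) ((Fintype.card B : ℤ) - r)).toNat)) := by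
  open QCoxeter in
  have hdual : dualCode (coxeterCode cs ((Fintype.card B : ℤ) - q - 1)) = coxeterCode cs q := by
    rw [dualCode_coxeterCode cs (by omega) (by omega)]
    congr 1
    ring
  have hle : dualCode (coxeterCode cs ((Fintype.card B : ℤ) - q - 1)) ≤ coxeterCode cs r :=
    hdual ▸ coxeterCode_mono cs hqr hr
  refine ⟨hle, ⟨isStabilizerGroup_css hle, rfl, ?_⟩, fun hlt => hasDistance_css hle ?_⟩
  · rw [quantumCoxeter, finrank_codeSpace_css hle, hdual,
      ← finrank_coxeterCode_add_sum_eulerian cs hq hqr hr, Nat.add_sub_cancel_left]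
  · rw [hdual, dualCode_coxeterCode cs (hq.trans hqr) hr]
    exact isLeast_hammingNorm_coxeterCode_diff cs hq hlt hr
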